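/- Let $d\ge 1$ be an integer, let $\omega=e^{2\pi i/(2d-1)}$ and $\nu=e^{2\pi i/3}$. There is a map $R:\mathbb R^{8d-4}\to\mathbb C^d$, depending only on $d$, with the following property. For all positive constants $m,M,M'$, put $$\beta=\frac{1}{1+2\left(1+\frac{(d-1)M+M'}{m}\right)} .$$ Then there is a constant $C$, depending only on $d,m,M,M'$, such that for every complex polynomial $f(z)=\sum_{k=0}^{d-1}c_kz^k$ of degree at most $d-1$ with $m\le|f(z)|\le M$ and $|f'(z)|\le M'$ for all $z$ on the unit circle there is a nonzero complex number $\lambda$ such that the following holds. Let $0<\epsilon<\frac{\beta m^2}{(2d-1)d}$ and let $\epsilon_{l,j}$ ($0\le l\le 2d-2$, $0\le j\le 3$) be real numbers with $|\epsilon_{l,j}|\le\epsilon$. If $R$ is applied to the $8d-4$ noisy values, namely the $2d-1$ values $$|f(\omega^l)|^2+\epsilon_{l,0}\qquad(0\le l\le 2d-2)$$ and the $6d-3$ values $$|f(\omega^l)+\nu^jf'(\omega^l)|^2+\epsilon_{l,j}\qquad(0\le l\le 2d-2,\ 1\le j\le 3),$$ then the result $(\tilde c_0,\dots,\tilde c_{d-1})$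 satisfies $$|\lambda\tilde c_k-c_k|\le C\epsilon\qquad(0\le k\le d-1).$$ -/

import Mathlib

namespace StableRecovery

/-- The primitive `(2d-1)`-th root of unity `ω = exp (2πi / (2d-1))`. -/
noncomputable def omega (d : ℕ) : ℂ :=
  Complex.exp (2 * (Real.pi : ℂ) * Complex.I / (2 * (d : ℂ) - 1))

/-- The primitive cube root of unity `ν = exp (2πi / 3)`. -/
noncomputable def nu : ℂ :=
  Complex.exp (2 * (Real.pi : ℂ) * Complex.I / 3)

/-- The `4 (2d-1) = 8d-4` noiseless measurements of a polynomial `f`: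
`|f(ω^l)|²` for `j = 0`, and `|f(ω^l) + ν^j f'(ω^l)|²` for `j = 1, 2, 3`,
where `l = 0, …, 2d-2`. -/
noncomputable def measurement (d : ℕ) (f : Polynomial ℂ) (l : Fin (2 * d - 1)) (j : Fin 4) : ℝ :=
  if j = 0 then
    ‖f.eval (omega d ^ (l : ℕ))‖ ^ 2
  else
    ‖f.eval (omega d ^ (l : ℕ)) + nu ^ (j : ℕ) * f.derivative.eval (omega d ^ (l : ℕ))‖ ^ 2

/-- The constant `β = 1 / (1 + 2 (1 + ((d-1) M + M') / m))`. -/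
noncomputable def beta (d : ℕ) (m M M' : ℝ) : ℝ :=
  1 / (1 + 2 * (1 + (((d : ℝ) - 1) * M + M') / m))

end StableRecovery

/-!
The recovery map returns a best sup-norm fit to the data: among the polynomials `g` of degree less
than `d` it picks one whose measurements are closest to the noisy values (a minimiser exists because
the measurements are coercive in the coefficients), and scales it to `g(1) = 1`. The constant
attached to `f` is then `f(1)`, which depends on `f` alone.

If the noise is at most `ε`, the measurements of `f` and `g` differ by at most `2ε`
(`abs_measurement_bestFit_sub_le`). By polarization over the cube roots of unity this controls
both `|g|² - |f|²` and `g' ḡ - f' f̄` at the `2d - 1` nodes. On the unit circle both are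
trigonometric polynomials of degree at most `d - 1`, so inversion of the discrete Fourier transform
controls them on the whole circle, by `2(2d-1)ε`
(`norm_eval_mul_conj_sub_le`). The bound on `ε` keeps `|g|² ≥ m²/3`, and the identity
`(g'f - gf') f̄ ḡ = (g'ḡ - f'f̄)|f|² - (|g|² - |f|²) f'f̄` shows that the Wronskian `g'f - gf'` is
`O(ε)`. It is the numerator of `(g/f)'`, so the mean value inequality along the circle gives
`g/f = g(1)/f(1) + O(ε)` (`norm_div_sub_div_le_of_wronskian`). Hence
`f(1) g/g(1) - f = O(ε)` on the circle, and the same holds for each coefficient.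
-/

open Polynomial ComplexConjugate

namespace StableRecovery

/-! ### Sampling polynomials at roots of unity -/

/-- Inversion of the discrete Fourier transform. -/
theorem sum_inv_pow_mul_eval_eq {N : ℕ} {ω : ℂ} (hω : IsPrimitiveRoot ω N) {P : ℂ[X]}
    (hP : P.natDegree < N) {k : ℕ} (hk : k < N) :
    ∑ l ∈ Finset.range N, ((ω ^ k)⁻¹) ^ l * P.eval (ω ^ l) = N * P.coeff k := by
  have hN : N ≠ 0 := by omega
  have hω0 : ω ≠ 0 := hω.ne_zero hN
  calc ∑ l ∈ Finset.range N, ((ω ^ k)⁻¹) ^ l * P.eval (ω ^ l)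
      = ∑ l ∈ Finset.range N, ∑ j ∈ Finset.range N,
          P.coeff j * (ω ^ j * (ω ^ k)⁻¹) ^ l := by
        refine Finset.sum_congr rfl fun l _ => ?_
        rw [eval_eq_sum_range' hP, Finset.mul_sum]
        refine Finset.sum_congr rfl fun j _ => ?_
        rw [mul_pow, ← pow_mul, ← pow_mul, mul_comm l j]
        ring
    _ = ∑ j ∈ Finset.range N, P.coeff j * ∑ l ∈ Finset.range N, (ω ^ j * (ω ^ k)⁻¹) ^ l := by
        rw [Finset.sum_comm]
        exact Finset.sum_congr rfl fun j _ => (Finset.mul_sum _ _ _).symm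
    _ = P.coeff k * ∑ l ∈ Finset.range N, (ω ^ k * (ω ^ k)⁻¹) ^ l := by
        refine Finset.sum_eq_single_of_mem k (Finset.mem_range.2 hk) fun j hj hjk => ?_
        have hne : ω ^ j * (ω ^ k)⁻¹ ≠ 1 := fun h =>
          hjk (hω.pow_inj (Finset.mem_range.1 hj) hk
            ((mul_inv_eq_one₀ (pow_ne_zero k hω0)).1 h))
        have hpow : (ω ^ j * (ω ^ k)⁻¹) ^ N = 1 := by
          rw [mul_pow, inv_pow, pow_right_comm, pow_right_comm ω k, hω.pow_eq_one]
          simp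
        rw [geom_sum_eq hne, hpow]
        simp
    _ = N * P.coeff k := by
        rw [mul_inv_cancel₀ (pow_ne_zero k hω0)]
        simp [mul_comm]

theorem norm_coeff_le_of_norm_eval_le {N : ℕ} {ω : ℂ} (hω : IsPrimitiveRoot ω N) {P : ℂ[X]}
    (hP : P.natDegree < N) {δ : ℝ} (h : ∀ l < N, ‖P.eval (ω ^ l)‖ ≤ δ) (k : ℕ) :
    ‖P.coeff k‖ ≤ δ := by
  have hN : N ≠ 0 := by omega
  rcases lt_or_ge k N with hk | hk
  · have hN' : (0 : ℝ) < N := by positivity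
    have hnorm : ‖ω‖ = 1 := hω.norm'_eq_one hN
    refine le_of_mul_le_mul_left ?_ hN'
    calc (N : ℝ) * ‖P.coeff k‖ = ‖(N : ℂ) * P.coeff k‖ := by simp
      _ = ‖∑ l ∈ Finset.range N, ((ω ^ k)⁻¹) ^ l * P.eval (ω ^ l)‖ := by
        rw [sum_inv_pow_mul_eval_eq hω hP hk]
      _ ≤ ∑ _l ∈ Finset.range N, δ := by
        refine norm_sum_le_of_le _ fun l hl => ?_
        simpa [hnorm] using h l (Finset.mem_range.1 hl)
      _ = N * δ := by simp
  · rw [coeff_eq_zero_of_natDegree_lt (hP.trans_le hk), norm_zero]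
    exact (norm_nonneg _).trans (h 0 (by omega))

theorem norm_eval_le_of_norm_eval_le {N : ℕ} {ω : ℂ} (hω : IsPrimitiveRoot ω N) {P : ℂ[X]}
    (hP : P.natDegree < N) {δ : ℝ} (h : ∀ l < N, ‖P.eval (ω ^ l)‖ ≤ δ) {z : ℂ} (hz : ‖z‖ = 1) :
    ‖P.eval z‖ ≤ N * δ := by
  rw [eval_eq_sum_range' hP]
  calc ‖∑ i ∈ Finset.range N, P.coeff i * z ^ i‖ ≤ ∑ _i ∈ Finset.range N, δ := by
        refine norm_sum_le_of_le _ fun k _ => ?_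
        simpa [hz] using norm_coeff_le_of_norm_eval_le hω hP h k
    _ = N * δ := by simp

/-- On the unit circle `p q̄` is a trigonometric polynomial: multiplied by `z ^ n` it is an honest
polynomial of degree at most `2 n`. -/
theorem exists_eval_eq_pow_mul_conj {n : ℕ} {p q : ℂ[X]} (hp : p.natDegree ≤ n)
    (hq : q.natDegree ≤ n) :
    ∃ P : ℂ[X], P.natDegree ≤ 2 * n ∧
      ∀ z : ℂ, ‖z‖ = 1 → P.eval z = z ^ n * (p.eval z * conj (q.eval z)) := by
  have hq' : (q.map (starRingEnd ℂ)).natDegree ≤ n := natDegree_map_le.trans hq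
  refine ⟨p * (q.map (starRingEnd ℂ)).reflect n, ?_, fun z hz => ?_⟩
  · refine natDegree_mul_le.trans ?_
    have := natDegree_reflect_le (N := n) (p := q.map (starRingEnd ℂ))
    rw [max_eq_left hq'] at this
    omega
  · have hzz : z * conj z = 1 := by rw [Complex.mul_conj']; simp [hz]
    let _ : Invertible (conj z) := ⟨z, hzz, by rw [mul_comm]; exact hzz⟩
    have h := eval₂_reflect_mul_pow (RingHom.id ℂ) (conj z) n _ hq'
    have hinv : ⅟(conj z) = z := rfl
    rw [hinv, ← eval, ← eval, eval_map, eval₂_at_apply] at h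
    rw [eval_mul, ← h]
    calc _ = p.eval z * eval z (reflect n (q.map (starRingEnd ℂ))) * (z * conj z) ^ n := by
          rw [hzz]; simp
      _ = _ := by ring

theorem norm_eval_mul_conj_sub_le {n N : ℕ} (hN : N = 2 * n + 1) {ω : ℂ}
    (hω : IsPrimitiveRoot ω N) {p q r s : ℂ[X]} (hp : p.natDegree ≤ n) (hq : q.natDegree ≤ n)
    (hr : r.natDegree ≤ n) (hs : s.natDegree ≤ n) {δ : ℝ}
    (h : ∀ l < N, ‖p.eval (ω ^ l) * conj (q.eval (ω ^ l))
      - r.eval (ω ^ l) * conj (s.eval (ω ^ l))‖ ≤ δ) {z : ℂ} (hz : ‖z‖ = 1) :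
    ‖p.eval z * conj (q.eval z) - r.eval z * conj (s.eval z)‖ ≤ N * δ := by
  obtain ⟨P, hP, hPe⟩ := exists_eval_eq_pow_mul_conj hp hq
  obtain ⟨Q, hQ, hQe⟩ := exists_eval_eq_pow_mul_conj hr hs
  have key : ∀ w : ℂ, ‖w‖ = 1 → ‖(P - Q).eval w‖ =
      ‖p.eval w * conj (q.eval w) - r.eval w * conj (s.eval w)‖ := fun w hw => by
    rw [eval_sub, hPe w hw, hQe w hw, ← mul_sub, norm_mul, norm_pow, hw, one_pow, one_mul]
  have hdeg : (P - Q).natDegree < N :=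
    (natDegree_sub_le_of_le hP hQ).trans_lt (by simp [hN])
  have hnorm : ‖ω‖ = 1 := hω.norm'_eq_one (by omega)
  rw [← key z hz]
  refine norm_eval_le_of_norm_eval_le hω hdeg (fun l hl => ?_) hz
  rw [key _ (by simp [hnorm])]
  exact h l hl

/-! ### The measurements -/

theorem isPrimitiveRoot_omega {d : ℕ} (hd : 1 ≤ d) : IsPrimitiveRoot (omega d) (2 * d - 1) := by
  have h := Complex.isPrimitiveRoot_exp (2 * d - 1) (by omega)
  rwa [Nat.cast_sub (by omega), Nat.cast_mul, Nat.cast_ofNat, Nat.cast_one] at h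

theorem isPrimitiveRoot_nu : IsPrimitiveRoot nu 3 := by
  simpa [nu] using Complex.isPrimitiveRoot_exp 3 (by norm_num)

theorem norm_nu : ‖nu‖ = 1 := isPrimitiveRoot_nu.norm'_eq_one (by norm_num)

/-- Polarization over the cube roots of unity. -/
theorem three_mul_mul_conj_eq (a b : ℂ) :
    3 * (b * conj a) =
      nu ^ 2 * (‖a + nu * b‖ ^ 2 : ℝ) + nu * (‖a + nu ^ 2 * b‖ ^ 2 : ℝ)
        + (‖a + nu ^ 3 * b‖ ^ 2 : ℝ) := by
  have h3 : nu ^ 3 = 1 := isPrimitiveRoot_nu.pow_eq_one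
  have hs : 1 + nu + nu ^ 2 = 0 := by
    simpa [Finset.sum_range_succ] using isPrimitiveRoot_nu.geom_sum_eq_zero (by norm_num)
  have hc : conj nu = nu ^ 2 := by
    have h1 : nu * conj nu = 1 := by rw [Complex.mul_conj']; simp [norm_nu]
    calc conj nu = nu ^ 3 * conj nu := by rw [h3, one_mul]
      _ = nu ^ 2 * (nu * conj nu) := by ring
      _ = nu ^ 2 := by rw [h1, mul_one]
  push_cast
  rw [← Complex.mul_conj', ← Complex.mul_conj', ← Complex.mul_conj']
  simp only [map_add, map_mul, map_pow, hc]
  have h4 : nu ^ 4 = nu := by rw [pow_succ, h3, one_mul]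
  grind

theorem measurement_zero (d : ℕ) (f : ℂ[X]) (l : Fin (2 * d - 1)) :
    measurement d f l 0 = ‖f.eval (omega d ^ (l : ℕ))‖ ^ 2 := by
  simp [measurement]

/-- Nearby measurements force the products `f' f̄` to be close at the nodes. -/
theorem norm_derivative_mul_conj_sub_le {d : ℕ} {f g : ℂ[X]} {l : Fin (2 * d - 1)} {δ : ℝ}
    (h : ∀ j, |measurement d g l j - measurement d f l j| ≤ δ) :
    ‖g.derivative.eval (omega d ^ (l : ℕ)) * conj (g.eval (omega d ^ (l : ℕ)))
      - f.derivative.eval (omega d ^ (l : ℕ)) * conj (f.eval (omega d ^ (l : ℕ)))‖ ≤ δ := by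
  have key : ∀ p : ℂ[X],
      3 * (p.derivative.eval (omega d ^ (l : ℕ)) * conj (p.eval (omega d ^ (l : ℕ)))) =
        nu ^ 2 * (measurement d p l 1 : ℂ) + nu * (measurement d p l 2 : ℂ)
          + (measurement d p l 3 : ℂ) := fun p => by
    rw [three_mul_mul_conj_eq]
    simp [measurement]
  have hj : ∀ j, ‖(measurement d g l j : ℂ) - measurement d f l j‖ ≤ δ := fun j => by
    rw [← Complex.ofReal_sub, Complex.norm_real]
    exact h j
  set u := g.derivative.eval (omega d ^ (l : ℕ)) * conj (g.eval (omega d ^ (l : ℕ)))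
  set v := f.derivative.eval (omega d ^ (l : ℕ)) * conj (f.eval (omega d ^ (l : ℕ)))
  have h3 : 3 * (u - v) = nu ^ 2 * ((measurement d g l 1 : ℂ) - measurement d f l 1)
      + nu * ((measurement d g l 2 : ℂ) - measurement d f l 2)
      + ((measurement d g l 3 : ℂ) - measurement d f l 3) := by
    rw [mul_sub, key g, key f]
    ring
  have hle : ‖3 * (u - v)‖ ≤ δ + δ + δ := by
    rw [h3]
    refine norm_add₃_le.trans (add_le_add (add_le_add ?_ ?_) (hj 3))
    · simpa [norm_nu] using hj 1
    · simpa [norm_nu] using hj 2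
  rw [norm_mul, Complex.norm_ofNat] at hle
  linarith

/-! ### Best sup-norm fit -/

theorem continuous_measurement_ofFn (d : ℕ) :
    Continuous fun (a : Fin d → ℂ) (l : Fin (2 * d - 1)) (j : Fin 4) =>
      measurement d (ofFn d a) l j := by
  have he : ∀ z : ℂ, Continuous fun a : Fin d → ℂ => (ofFn d a).eval z := fun z =>
    ((leval z).comp (ofFn d)).continuous_of_finiteDimensional
  have hd : ∀ z : ℂ, Continuous fun a : Fin d → ℂ => (ofFn d a).derivative.eval z := fun z =>
    ((leval z).comp (derivative.comp (ofFn d))).continuous_of_finiteDimensional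
  refine continuous_pi fun l => continuous_pi fun j => ?_
  unfold measurement
  split_ifs
  · exact (he _).norm.pow 2
  · exact ((he _).add (continuous_const.mul (hd _))).norm.pow 2

/-- Coercivity of the measurements. -/
theorem sq_norm_le_norm_measurement_ofFn {d : ℕ} (hd : 1 ≤ d) (a : Fin d → ℂ) :
    ‖a‖ ^ 2 ≤ ‖fun l j => measurement d (ofFn d a) l j‖ := by
  set y : Fin (2 * d - 1) → Fin 4 → ℝ := fun l j => measurement d (ofFn d a) l j
  have hdeg : (ofFn d a).natDegree < 2 * d - 1 := (ofFn_natDegree_lt hd a).trans_le (by omega)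
  refine (Real.le_sqrt (norm_nonneg _) (norm_nonneg _)).1
    ((pi_norm_le_iff_of_nonneg (Real.sqrt_nonneg _)).2 fun k => ?_)
  rw [← ofFn_coeff_eq_val_of_lt a k.2]
  refine norm_coeff_le_of_norm_eval_le (isPrimitiveRoot_omega hd) hdeg (fun l hl => ?_) _
  refine Real.le_sqrt_of_sq_le ?_
  calc ‖(ofFn d a).eval (omega d ^ l)‖ ^ 2 = y ⟨l, hl⟩ 0 := (measurement_zero d _ ⟨l, hl⟩).symm
    _ ≤ ‖y ⟨l, hl⟩ 0‖ := Real.le_norm_self _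
    _ ≤ ‖y‖ := (norm_le_pi_norm _ _).trans (norm_le_pi_norm y _)

theorem exists_measurement_minimizer {d : ℕ} (hd : 1 ≤ d) (y : Fin (2 * d - 1) → Fin 4 → ℝ) :
    ∃ a : Fin d → ℂ, ∀ b : Fin d → ℂ,
      ‖(fun l j => measurement d (ofFn d a) l j) - y‖
        ≤ ‖(fun l j => measurement d (ofFn d b) l j) - y‖ := by
  refine ((continuous_measurement_ofFn d).sub continuous_const).norm.exists_forall_le ?_
  have hsq : Filter.Tendsto (fun a : Fin d → ℂ => ‖a‖ ^ 2 - ‖y‖)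
      (Filter.cocompact _) Filter.atTop :=
    Filter.tendsto_atTop_add_const_right _ _
      ((Filter.tendsto_pow_atTop two_ne_zero).comp tendsto_norm_cocompact_atTop)
  refine Filter.tendsto_atTop_mono (fun a => ?_) hsq
  have h1 := sq_norm_le_norm_measurement_ofFn hd a
  have h2 := norm_sub_norm_le (fun l j => measurement d (ofFn d a) l j) y
  exact (sub_le_sub_right h1 _).trans h2

/-- The coefficients of a polynomial of degree less than `d` whose measurements are nearest to `y`
in the sup norm. -/
noncomputable def bestFit {d : ℕ} (hd : 1 ≤ d) (y : Fin (2 * d - 1) → Fin 4 → ℝ) : Fin d → ℂ :=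
  (exists_measurement_minimizer hd y).choose

theorem abs_measurement_bestFit_sub_le {d : ℕ} (hd : 1 ≤ d) {f : ℂ[X]} (hf : f.natDegree < d)
    {e : Fin (2 * d - 1) → Fin 4 → ℝ} {ε : ℝ} (hε : 0 ≤ ε) (he : ∀ l j, |e l j| ≤ ε)
    (l : Fin (2 * d - 1)) (j : Fin 4) :
    |measurement d (ofFn d (bestFit hd fun l j => measurement d f l j + e l j)) l j
      - measurement d f l j| ≤ 2 * ε := by
  set y : Fin (2 * d - 1) → Fin 4 → ℝ := fun l j => measurement d f l j + e l j
  have hmin := (exists_measurement_minimizer hd y).choose_spec (toFn d f)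
  rw [ofFn_comp_toFn_eq_id_of_natDegree_lt hf] at hmin
  have hfit : ‖(fun l j => measurement d f l j) - y‖ ≤ ε := by
    refine (pi_norm_le_iff_of_nonneg hε).2 fun l => (pi_norm_le_iff_of_nonneg hε).2 fun j => ?_
    simpa [y] using he l j
  have hlj : |measurement d (ofFn d (bestFit hd y)) l j - y l j| ≤ ε :=
    ((norm_le_pi_norm (((fun l j => measurement d (ofFn d (bestFit hd y)) l j) - y) l) j).trans
      (norm_le_pi_norm _ l)).trans (hmin.trans hfit)
  have h1 := abs_le.1 hlj
  have h2 := abs_le.1 (he l j)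
  simp only [y] at h1
  rw [abs_le]
  constructor <;> linarith

/-! ### Stability of the quotient along the unit circle -/

/-- The Wronskian of `f` and `g` is the numerator of `(g/f)'`, so a bound for it on the unit circle
makes `g/f` nearly constant there. -/
theorem norm_div_sub_div_le_of_wronskian {f g : ℂ[X]} {m K : ℝ} (hm : 0 < m)
    (hf : ∀ z : ℂ, ‖z‖ = 1 → m ≤ ‖f.eval z‖)
    (hW : ∀ z : ℂ, ‖z‖ = 1 → ‖g.derivative.eval z * f.eval z - g.eval z * f.derivative.eval z‖ ≤ K)
    {z : ℂ} (hz : ‖z‖ = 1) :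
    ‖g.eval z / f.eval z - g.eval 1 / f.eval 1‖ ≤ K / m ^ 2 * Real.pi := by
  have hK : 0 ≤ K := (norm_nonneg _).trans (hW 1 norm_one)
  set γ : ℝ → ℂ := fun t => Complex.exp (t * Complex.I)
  have hγn : ∀ t, ‖γ t‖ = 1 := fun t => Complex.norm_exp_ofReal_mul_I t
  have hγ : ∀ t, HasDerivAt γ (γ t * Complex.I) t := fun t => by
    simpa using ((Complex.ofRealCLM.hasDerivAt (x := t)).mul_const Complex.I).cexp
  have hne : ∀ t, f.eval (γ t) ≠ 0 := fun t =>
    norm_pos_iff.1 (hm.trans_le (hf _ (hγn t)))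
  have hder : ∀ t, HasDerivAt (fun s => g.eval (γ s) / f.eval (γ s))
      ((g.derivative.eval (γ t) * f.eval (γ t) - g.eval (γ t) * f.derivative.eval (γ t))
        / f.eval (γ t) ^ 2 * (γ t * Complex.I)) t := fun t =>
    (((g.hasDerivAt (γ t)).div (f.hasDerivAt (γ t)) (hne t))).comp t (hγ t)
  have hbound : ∀ t, ‖(g.derivative.eval (γ t) * f.eval (γ t)
      - g.eval (γ t) * f.derivative.eval (γ t)) / f.eval (γ t) ^ 2 * (γ t * Complex.I)‖
        ≤ K / m ^ 2 := fun t => by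
    rw [norm_mul, norm_mul, hγn, Complex.norm_I, mul_one, mul_one, norm_div, norm_pow]
    exact div_le_div₀ hK (hW _ (hγn t)) (by positivity)
      (pow_le_pow_left₀ hm.le (hf _ (hγn t)) 2)
  have hmv := convex_univ.norm_image_sub_le_of_norm_hasDerivWithin_le
    (fun t _ => (hder t).hasDerivWithinAt) (fun t _ => hbound t)
    (Set.mem_univ (0 : ℝ)) (Set.mem_univ z.arg)
  have hz' : γ z.arg = z := by simpa [hz] using Complex.norm_mul_exp_arg_mul_I z
  have h0 : γ 0 = 1 := by simp [γ]
  rw [hz', h0, sub_zero, Real.norm_eq_abs] at hmv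
  exact hmv.trans (mul_le_mul_of_nonneg_left (Complex.abs_arg_le_pi z) (by positivity))

/-- If `|g|² - |f|²` and `g' ḡ - f' f̄` are at most `η` on the unit circle, then `f` is close there
to a multiple of `g`. -/
theorem norm_mul_div_sub_le {f g : ℂ[X]} {m M M' η : ℝ} (hm : 0 < m) (hM : 0 < M) (hM' : 0 < M')
    (hf : ∀ z : ℂ, ‖z‖ = 1 → m ≤ ‖f.eval z‖ ∧ ‖f.eval z‖ ≤ M)
    (hf' : ∀ z : ℂ, ‖z‖ = 1 → ‖f.derivative.eval z‖ ≤ M')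
    (hη : η ≤ 2 * m ^ 2 / 3)
    (h1 : ∀ z : ℂ, ‖z‖ = 1 →
      ‖g.eval z * conj (g.eval z) - f.eval z * conj (f.eval z)‖ ≤ η)
    (h2 : ∀ z : ℂ, ‖z‖ = 1 →
      ‖g.derivative.eval z * conj (g.eval z) - f.derivative.eval z * conj (f.eval z)‖ ≤ η)
    {z : ℂ} (hz : ‖z‖ = 1) :
    ‖f.eval 1 * (g.eval z / g.eval 1) - f.eval z‖
      ≤ 4 * Real.pi * (M + M') * M ^ 2 / m ^ 4 * η := by
  have hη0 : 0 ≤ η := (norm_nonneg _).trans (h1 1 norm_one)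
  have hg : ∀ w : ℂ, ‖w‖ = 1 → m / 2 ≤ ‖g.eval w‖ := fun w hw => by
    have h := h1 w hw
    rw [Complex.mul_conj', Complex.mul_conj', ← Complex.ofReal_pow, ← Complex.ofReal_pow,
      ← Complex.ofReal_sub, Complex.norm_real] at h
    have hsq : m ^ 2 ≤ ‖f.eval w‖ ^ 2 := pow_le_pow_left₀ hm.le (hf w hw).1 2
    -- `|g|² ≥ m² - η ≥ m²/3 > (m/2)²`
    refine abs_le_of_sq_le_sq' ?_ (norm_nonneg _) |>.2
    nlinarith [(abs_le.1 h).1]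
  have hW : ∀ w : ℂ, ‖w‖ = 1 →
      ‖g.derivative.eval w * f.eval w - g.eval w * f.derivative.eval w‖
        ≤ 2 * (M + M') / m * η := fun w hw => by
    have hgw := hg w hw
    have hfw := hf w hw
    have hf0 : 0 < ‖f.eval w‖ := hm.trans_le hfw.1
    set W := g.derivative.eval w * f.eval w - g.eval w * f.derivative.eval w
    have hid : W * conj (f.eval w) * conj (g.eval w) =
        (g.derivative.eval w * conj (g.eval w) - f.derivative.eval w * conj (f.eval w))
            * f.eval w * conj (f.eval w)
          - (g.eval w * conj (g.eval w) - f.eval w * conj (f.eval w))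
            * f.derivative.eval w * conj (f.eval w) := by
      simp only [W]
      ring
    have hle : ‖W‖ * ‖f.eval w‖ * ‖g.eval w‖ ≤ (η * M + η * M') * ‖f.eval w‖ := by
      calc ‖W‖ * ‖f.eval w‖ * ‖g.eval w‖ = ‖W * conj (f.eval w) * conj (g.eval w)‖ := by
            simp
        _ ≤ η * M * ‖f.eval w‖ + η * M' * ‖f.eval w‖ := by
            rw [hid]
            refine norm_sub_le_of_le ?_ ?_
            · rw [norm_mul, norm_mul, Complex.norm_conj]
              gcongr
              exacts [h2 w hw, hfw.2]
            · rw [norm_mul, norm_mul, Complex.norm_conj]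
              gcongr
              exacts [h1 w hw, hf' w hw]
        _ = _ := by ring
    have hle' : ‖W‖ * ‖g.eval w‖ ≤ η * M + η * M' :=
      le_of_mul_le_mul_right (by linarith) hf0
    have hle'' : ‖W‖ * (m / 2) ≤ η * M + η * M' :=
      (mul_le_mul_of_nonneg_left hgw (norm_nonneg _)).trans hle'
    rw [div_mul_eq_mul_div, le_div_iff₀ hm]
    linarith
  have hquot := norm_div_sub_div_le_of_wronskian hm (fun w hw => (hf w hw).1) hW hz
  have hf1 := hf 1 norm_one
  have hg1 := hg 1 norm_one
  have hf1ne : f.eval 1 ≠ 0 := norm_pos_iff.1 (hm.trans_le hf1.1)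
  have hg1ne : g.eval 1 ≠ 0 := norm_pos_iff.1 ((half_pos hm).trans_le hg1)
  have hfzne : f.eval z ≠ 0 := norm_pos_iff.1 (hm.trans_le (hf z hz).1)
  have hid : f.eval 1 * (g.eval z / g.eval 1) - f.eval z =
      f.eval 1 * f.eval z * (g.eval z / f.eval z - g.eval 1 / f.eval 1) / g.eval 1 := by
    field_simp
  rw [hid, norm_div, norm_mul, norm_mul]
  calc ‖f.eval 1‖ * ‖f.eval z‖ * ‖g.eval z / f.eval z - g.eval 1 / f.eval 1‖ / ‖g.eval 1‖
      ≤ M * M * (2 * (M + M') / m * η / m ^ 2 * Real.pi) / (m / 2) := by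
        gcongr
        exacts [hf1.2, (hf z hz).2]
    _ = 4 * Real.pi * (M + M') * M ^ 2 / m ^ 4 * η := by
        field_simp
        ring

/-! ### Recovery -/

theorem beta_le {d : ℕ} (hd : 1 ≤ d) {m M M' : ℝ} (hm : 0 < m) (hM : 0 < M) (hM' : 0 < M') :
    beta d m M M' ≤ 1 / 3 := by
  have hd' : (0 : ℝ) ≤ (d : ℝ) - 1 := by
    have : (1 : ℝ) ≤ d := by exact_mod_cast hd
    linarith
  have hpos : 0 ≤ (((d : ℝ) - 1) * M + M') / m := by positivity
  unfold beta
  exact one_div_le_one_div_of_le (by norm_num) (by linarith)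

end StableRecovery

open StableRecovery in
theorem mainTheorem2 (d : ℕ) (hd : 1 ≤ d) :
    -- a recovery map, which sees nothing but the `8d-4` noisy values
    ∃ R : (Fin (2 * d - 1) → Fin 4 → ℝ) → (Fin d → ℂ),
      ∀ m M M' : ℝ, 0 < m → 0 < M → 0 < M' →
        -- the constant in `O(ε)` depends only on `d, m, M, M'`
        ∃ C : ℝ, ∀ f : Polynomial ℂ, f.degree < (d : WithBot ℕ) →
          (∀ z : ℂ, ‖z‖ = 1 → m ≤ ‖f.eval z‖ ∧ ‖f.eval z‖ ≤ M) →
          (∀ z : ℂ, ‖z‖ = 1 → ‖f.derivative.eval z‖ ≤ M') →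
          -- the undetermined multiplicative constant depends on `f`, not on the noise
          ∃ c : ℂ, c ≠ 0 ∧
            ∀ ε : ℝ, 0 < ε →
              ε < StableRecovery.beta d m M M' * m ^ 2 / ((2 * (d : ℝ) - 1) * (d : ℝ)) →
              ∀ e : Fin (2 * d - 1) → Fin 4 → ℝ, (∀ l j, |e l j| ≤ ε) →
                ∀ k : Fin d,
                  ‖c * R (fun l j => StableRecovery.measurement d f l j + e l j) k
                    - f.coeff (k : ℕ)‖ ≤ C * ε := by
  refine ⟨fun y k => bestFit hd y k / (ofFn d (bestFit hd y)).eval 1, fun m M M' hm hM hM' =>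
    ⟨4 * Real.pi * (M + M') * M ^ 2 / m ^ 4 * ((2 * d - 1) * 2),
      fun f hfd hf hf' => ⟨f.eval 1, norm_pos_iff.1 (hm.trans_le (hf 1 norm_one).1),
        fun ε hε hεlt e he k => ?_⟩⟩⟩
  have hdR : (1 : ℝ) ≤ d := by exact_mod_cast hd
  have hN : ((2 * d - 1 : ℕ) : ℝ) = 2 * d - 1 := by
    rw [Nat.cast_sub (by omega)]
    push_cast
    ring
  have hfn : f.natDegree < d := by
    rcases eq_or_ne f 0 with rfl | h0
    · rw [natDegree_zero]
      omega
    · exact (natDegree_lt_iff_degree_lt h0).2 hfd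
  set y : Fin (2 * d - 1) → Fin 4 → ℝ := fun l j => measurement d f l j + e l j
  set g : ℂ[X] := ofFn d (bestFit hd y) with hgdef
  have hgn : g.natDegree < d := ofFn_natDegree_lt hd _
  have hmeas : ∀ l j, |measurement d g l j - measurement d f l j| ≤ 2 * ε :=
    abs_measurement_bestFit_sub_le hd hfn hε.le he
  have hω := isPrimitiveRoot_omega hd
  have hdeg : ∀ p : ℂ[X], p.natDegree < d → p.natDegree ≤ d - 1 := fun p hp => by omega
  have hderiv : ∀ p : ℂ[X], p.natDegree < d → p.derivative.natDegree ≤ d - 1 := fun p hp =>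
    (natDegree_derivative_le p).trans (by omega)
  set η : ℝ := (2 * d - 1) * (2 * ε) with hη
  have h1 : ∀ z : ℂ, ‖z‖ = 1 →
      ‖g.eval z * conj (g.eval z) - f.eval z * conj (f.eval z)‖ ≤ η := fun z hz => by
    rw [hη, ← hN]
    refine norm_eval_mul_conj_sub_le (by omega) hω (hdeg g hgn) (hdeg g hgn) (hdeg f hfn)
      (hdeg f hfn) (fun l hl => ?_) hz
    have h := hmeas ⟨l, hl⟩ 0
    rw [measurement_zero, measurement_zero] at h
    rw [Complex.mul_conj', Complex.mul_conj', ← Complex.ofReal_pow, ← Complex.ofReal_pow,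
      ← Complex.ofReal_sub, Complex.norm_real]
    exact h
  have h2 : ∀ z : ℂ, ‖z‖ = 1 → ‖g.derivative.eval z * conj (g.eval z)
      - f.derivative.eval z * conj (f.eval z)‖ ≤ η := fun z hz => by
    rw [hη, ← hN]
    exact norm_eval_mul_conj_sub_le (by omega) hω (hderiv g hgn) (hdeg g hgn) (hderiv f hfn)
      (hdeg f hfn) (fun l hl => norm_derivative_mul_conj_sub_le (hmeas ⟨l, hl⟩)) hz
  -- The hypothesis on `ε` keeps `|g|²` above `m²/3`, because `β ≤ 1/3`.
  have hηle : η ≤ 2 * m ^ 2 / 3 := by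
    have hden : 0 < (2 * (d : ℝ) - 1) * d := mul_pos (by linarith) (by linarith)
    rw [lt_div_iff₀ hden] at hεlt
    have hβ : beta d m M M' * m ^ 2 ≤ 1 / 3 * m ^ 2 :=
      mul_le_mul_of_nonneg_right (beta_le hd hm hM hM') (sq_nonneg m)
    have hnn : 0 ≤ ε * (2 * (d : ℝ) - 1) := mul_nonneg hε.le (by linarith)
    have hmono : ε * (2 * (d : ℝ) - 1) ≤ ε * (2 * (d : ℝ) - 1) * d :=
      le_mul_of_one_le_right hnn hdR
    rw [hη]
    linarith
  have hclose : ∀ z : ℂ, ‖z‖ = 1 → ‖(C (f.eval 1 / g.eval 1) * g - f).eval z‖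
      ≤ 4 * Real.pi * (M + M') * M ^ 2 / m ^ 4 * η := fun z hz => by
    have h := norm_mul_div_sub_le hm hM hM' hf hf' hηle h1 h2 hz
    rwa [← mul_div_assoc, mul_div_right_comm, ← eval_C_mul, ← eval_sub] at h
  have hnd : (C (f.eval 1 / g.eval 1) * g - f).natDegree < 2 * d - 1 := by
    have := natDegree_sub_le_of_le ((natDegree_C_mul_le (f.eval 1 / g.eval 1) g).trans
      (hdeg g hgn)) (hdeg f hfn)
    rw [max_self] at this
    omega
  have hcoeff := norm_coeff_le_of_norm_eval_le hω hnd
    (fun l _ => hclose _ (by simp [hω.norm'_eq_one (by omega)])) k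
  rw [coeff_sub, coeff_C_mul, hgdef, ofFn_coeff_eq_val_of_lt _ k.2, ← hgdef] at hcoeff
  calc _ = ‖f.eval 1 / g.eval 1 * bestFit hd y k - f.coeff k‖ := by
        rw [mul_div_assoc', div_mul_eq_mul_div]
    _ ≤ _ := hcoeff
    _ = _ := by rw [hη]; ring
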